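/- **Setting.** For each sample size $n$ let $Y_i=f(x_i)+\varepsilon_i$, $i=1,\dots,n$, with fixed design points $x_i\in\mathbb R^p$ and independent errors $\varepsilon_i\sim N(0,\sigma^2)$, $\sigma^2>0$ fixed (the design, $p$ and $f$ may change with $n$). Let $\mathbf Y_n=(Y_1,\dots,Y_n)^T$ and $f_n=(f(x_1),\dots,f(x_n))^T$. Let $\Gamma=\Gamma_n$ index a list of candidate models; model $k$ is a family $\mathcal F_k=\{\sum_{i=1}^{m_k}\theta_i\varphi_{k,i}:\theta\in\mathbb R^{m_k}\}$ of regression functions. Let $M_k$ be the orthogonal projection of $\mathbb R^n$ onto the column space $\{(g(x_1),\dots,g(x_n))^T: g\in\mathcal F_k\}$ of model $k$ and $r_k$ the rank of $M_k$. Let $S_1(k)$ be the set of $k'\in\Gamma$ with $\mathcal F_{k'}\subseteq\mathcal F_k$ and $r_{k'}=r_k-1$; it is assumed non-empty whenever $r_k>1$. Let $N_j$ be the number of $k\in\Gamma$ with $r_k=j$ and, for $j>1$, $L_j=\max\{\operatorname{card}S_1(k): r_k=j\}$. Let $d\ge0$ be a constant and $\lambda_n\ge(\log n)^{-1}$ $(n\ge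 2)$ a sequence. Let $\hat k_n\in\Gamma$ be the (random) selected model, and put $\hat\sigma^2=\|\mathbf Y_n-M_{\hat k_n}\mathbf Y_n\|^2/(n-r_{\hat k_n})$, $$IC(k,\hat\sigma^2)=\|\mathbf Y_n-M_k\mathbf Y_n\|^2+\lambda_n\log(n)\,r_k\hat\sigma^2-n\hat\sigma^2+d\,n^{1/2}\log(n)\,\hat\sigma^2,$$ $$\mathrm{PI}_n=\inf_{k\in S_1(\hat k_n)}\frac{IC(k,\hat\sigma^2)}{IC(\hat k_n,\hat\sigma^2)}\ \text{ if } r_{\hat k_n}>1,\qquad \mathrm{PI}_n=n\ \text{ otherwise.}$$ For $k\in\Gamma$ with $r_k<n$ put $$G_n(k)=\bigl[(\lambda_n\log(n)-1)r_k+d\,n^{1/2}\log(n)\bigr]\Bigl[1+\frac{\|(I_n-M_k)f_n\|^2}{(n-r_k)\sigma^2}\Bigr],$$ and for each $j<n$ that is the rank of some candidate model put $E_{j,n}=\inf_{r_k=j}G_n(k)$ and $$B_{j,n}=\inf_{r_k=j}\bigl\{(\lambda_n\log(n)-1)j+\|(I_n-M_k)f_n\|^2/\sigma^2+d\,n^{1/2}\log(n)\bigr\}.$$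 **Theorem.** Suppose that the scenario is nonparametric, that is, for every $n$ and every $k\in\Gamma$ the true function $f$ is not in $\mathcal F_k$. Suppose that there are integers $a_n,b_n$ with $1\le a_n<b_n<n$ for all large $n$ and $a_n\to\infty$, such that the following conditions hold, where $j$ ranges over the ranks of candidate models: - (N1) $P(a_n\le r_{\hat k_n}\le b_n)\to1$ and $\sup_{a_n\le j\le b_n}B_{j,n}/(n-j)\to0$; - (N2′) there are a positive sequence $\rho_n\to0$ and a constant $c_0>0$ such that, for all large $n$, $N_jL_j\le c_0e^{\rho_nE_{j,n}}$ whenever $a_n\le j\le b_n$, and $\limsup_{n\to\infty}\sum_{j=a_n}^{b_n}e^{-\rho_nE_{j,n}}=0$; - (N3′) $\displaystyle\limsup_{n\to\infty}\ \sup_{k:\,a_n\le r_k\le b_n}\frac{\inf_{k'\in S_1(k)}\|(M_k-M_{k'})f_n\|^2}{G_n(k)}=0$. Then $\mathrm{PI}_n\to1$ in probability as $n\to\infty$. -/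

import Mathlib

open MeasureTheory ProbabilityTheory Filter Topology
open scoped ENNReal

universe u v

/-- A linear model on `ℝᵖ`: the regression functions are
`x ↦ ∑ i, θ i * basis i x` with a parameter `θ` of finite dimension `dim`. -/
structure LinearModel (p : ℕ) where
  dim : ℕ
  basis : Fin dim → (Fin p → ℝ) → ℝ

namespace LinearModel

variable {p : ℕ}

/-- The regression function with parameter `θ`. -/
def regFun (m : LinearModel p) (θ : Fin m.dim → ℝ) : (Fin p → ℝ) → ℝ :=
  fun x => ∑ i, θ i * m.basis i x

/-- The family of all regression functions of the model. -/
def family (m : LinearModel p) : Set ((Fin p → ℝ) → ℝ) := Set.range m.regFun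

/-- The column space of the design matrix of the model at the design points `x 0, …, x (n-1)`. -/
def colSpace (m : LinearModel p) {n : ℕ} (x : Fin n → Fin p → ℝ) :
    Submodule ℝ (EuclideanSpace ℝ (Fin n)) :=
  Submodule.span ℝ (Set.range fun i => WithLp.toLp 2 fun l => m.basis i (x l))

end LinearModel

/-- The data of a fixed-design regression problem at sample size `n`: the design points, the true
regression function, and the list of candidate linear models, indexed by `Γ`. -/
structure RegressionProblem (n p : ℕ) (Γ : Type u) where
  design : Fin n → Fin p → ℝ
  f : (Fin p → ℝ) → ℝ
  model : Γ → LinearModel p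

namespace RegressionProblem

variable {n p : ℕ} {Γ : Type u}

/-- The vector of the true regression function at the design points. -/
noncomputable def fvec (R : RegressionProblem n p Γ) : EuclideanSpace ℝ (Fin n) :=
  WithLp.toLp 2 fun l => R.f (R.design l)

/-- The response vector, `Y_l = f (x_l) + e_l`. -/
noncomputable def response (R : RegressionProblem n p Γ) (e : Fin n → ℝ) :
    EuclideanSpace ℝ (Fin n) :=
  WithLp.toLp 2 fun l => R.f (R.design l) + e l

/-- The projection matrix `M_k`: orthogonal projection onto the column space of model `k`. -/
noncomputable def M (R : RegressionProblem n p Γ) (k : Γ) :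
    EuclideanSpace ℝ (Fin n) →L[ℝ] EuclideanSpace ℝ (Fin n) :=
  ((R.model k).colSpace R.design).starProjection

/-- The rank `r_k` of `M_k`. -/
noncomputable def rank (R : RegressionProblem n p Γ) (k : Γ) : ℕ :=
  Module.finrank ℝ (R.M k).toLinearMap.range

/-- `S₁(k)`: the sub-models of `k` in the list whose rank is smaller by one. -/
def S₁ (R : RegressionProblem n p Γ) (k : Γ) : Set Γ :=
  {k' | (R.model k').family ⊆ (R.model k).family ∧ R.rank k' + 1 = R.rank k}

/-- `N_j`: the number of models of rank `j`. -/
noncomputable def N (R : RegressionProblem n p Γ) (j : ℕ) : ℕ∞ :=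
  {k | R.rank k = j}.encard

/-- `L_j`: the largest cardinality of `S₁(k)` among the models `k` of rank `j`. -/
noncomputable def L (R : RegressionProblem n p Γ) (j : ℕ) : ℕ∞ :=
  ⨆ k ∈ {k | R.rank k = j}, (R.S₁ k).encard

/-- Residual sum of squares `‖Y - M_k Y‖²`. -/
noncomputable def RSS (R : RegressionProblem n p Γ) (k : Γ) (Y : EuclideanSpace ℝ (Fin n)) : ℝ :=
  ‖Y - R.M k Y‖ ^ 2

/-- The variance estimate `‖Y - M_k Y‖² / (n - r_k)` from model `k`. -/
noncomputable def varEst (R : RegressionProblem n p Γ) (k : Γ)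
    (Y : EuclideanSpace ℝ (Fin n)) : ℝ :=
  R.RSS k Y / ((n : ℝ) - R.rank k)

/-- The information criterion `IC_{lam, d}(k, s2)`, where `s2` is the value used for `σ²`. -/
noncomputable def IC (R : RegressionProblem n p Γ) (lam d : ℝ) (k : Γ) (s2 : ℝ)
    (Y : EuclideanSpace ℝ (Fin n)) : ℝ :=
  R.RSS k Y + lam * Real.log n * R.rank k * s2 - n * s2 + d * √(n : ℝ) * Real.log n * s2

open Classical in
/-- The parametricness index when `khat` is the selected model and `σ²` is estimated from it. -/
noncomputable def PI (R : RegressionProblem n p Γ) (lam d : ℝ) (khat : Γ)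
    (Y : EuclideanSpace ℝ (Fin n)) : ℝ :=
  if 1 < R.rank khat then
    ⨅ k : R.S₁ khat,
      R.IC lam d k (R.varEst khat Y) Y / R.IC lam d khat (R.varEst khat Y) Y
  else n

/-- The squared approximation error `‖(I - M_k) f_n‖²`. -/
noncomputable def approxErr (R : RegressionProblem n p Γ) (k : Γ) : ℝ :=
  ‖R.fvec - R.M k R.fvec‖ ^ 2

/-- `B_{j,n}`; meaningful for the ranks `j < n` that occur in the list. -/
noncomputable def B (R : RegressionProblem n p Γ) (σ lam d : ℝ) (j : ℕ) : ℝ :=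
  ⨅ k : {k // R.rank k = j},
    ((lam * Real.log n - 1) * j + R.approxErr k / σ ^ 2 + d * √(n : ℝ) * Real.log n)

/-- The quantity `[(λ log n - 1) r_k + d √n log n] [1 + ‖(I - M_k) f_n‖² / ((n - r_k) σ²)]`. -/
noncomputable def penalty (R : RegressionProblem n p Γ) (σ lam d : ℝ) (k : Γ) : ℝ :=
  ((lam * Real.log n - 1) * R.rank k + d * √(n : ℝ) * Real.log n) *
    (1 + R.approxErr k / (((n : ℝ) - R.rank k) * σ ^ 2))

/-- `E_{j,n}`; meaningful for the ranks `j < n` that occur in the list. -/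
noncomputable def E (R : RegressionProblem n p Γ) (σ lam d : ℝ) (j : ℕ) : ℝ :=
  ⨅ k : {k // R.rank k = j}, R.penalty σ lam d k

open Classical in
/-- The ranks in `[a, b]` that occur in the list; for the others the infima defining `B` and `E`
are over the empty set. -/
noncomputable def ranks (R : RegressionProblem n p Γ) (a b : ℕ) : Finset ℕ :=
  (Finset.Icc a b).filter fun j => ∃ k, R.rank k = j

end RegressionProblem

section Conditions

variable {p : ℕ → ℕ} {Γ : ℕ → Type u}

/-- The selected rank is in `[a_n, b_n]` with probability tending to one, and
`sup_{a_n ≤ j ≤ b_n} B_{j,n} / (n - j) → 0`. -/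
def CondN1 {Ω : Type v} [MeasurableSpace Ω] (μ : Measure Ω)
    (R : ∀ n, RegressionProblem n (p n) (Γ n)) (σ : ℝ) (lam : ℕ → ℝ) (d : ℝ)
    (khat : ∀ n, Ω → Γ n) (a b : ℕ → ℕ) : Prop :=
  Tendsto (fun n => μ {ω | a n ≤ (R n).rank (khat n ω) ∧ (R n).rank (khat n ω) ≤ b n})
      atTop (𝓝 1) ∧
  Tendsto (fun n => ⨆ j ∈ (R n).ranks (a n) (b n),
      ENNReal.ofReal ((R n).B σ (lam n) d j / ((n : ℝ) - j))) atTop (𝓝 0)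

/-- For some positive `ρ_n → 0` and `c₀ > 0`: `N_j L_j ≤ c₀ exp (ρ_n E_{j,n})` for
`a_n ≤ j ≤ b_n` (`L_j` is used for `j > 1` only), and `∑_{j = a_n}^{b_n} exp (-ρ_n E_{j,n}) → 0`. -/
def CondN2' (R : ∀ n, RegressionProblem n (p n) (Γ n)) (σ : ℝ) (lam : ℕ → ℝ) (d : ℝ)
    (a b : ℕ → ℕ) : Prop :=
  ∃ (ρ : ℕ → ℝ) (c₀ : ℝ), (∀ n, 0 < ρ n) ∧ Tendsto ρ atTop (𝓝 0) ∧ 0 < c₀ ∧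
    (∀ᶠ n in atTop, ∀ j ∈ (R n).ranks (a n) (b n), 1 < j →
      (((R n).N j * (R n).L j : ℕ∞) : ℝ≥0∞) ≤
        ENNReal.ofReal (c₀ * Real.exp (ρ n * (R n).E σ (lam n) d j))) ∧
    Tendsto (fun n => ∑ j ∈ (R n).ranks (a n) (b n), Real.exp (-(ρ n * (R n).E σ (lam n) d j)))
      atTop (𝓝 0)

/-- The supremum over the models `k` with `a_n ≤ r_k ≤ b_n` of
`inf_{k' ∈ S₁(k)} ‖(M_k - M_{k'}) f_n‖²` divided by
`[(λ_n log n - 1) r_k + d √n log n] [1 + ‖(I - M_k) f_n‖² / (σ² (n - r_k))]` tends to zero. -/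
def CondN3' (R : ∀ n, RegressionProblem n (p n) (Γ n)) (σ : ℝ) (lam : ℕ → ℝ) (d : ℝ)
    (a b : ℕ → ℕ) : Prop :=
  Tendsto (fun n => ⨆ k ∈ {k | a n ≤ (R n).rank k ∧ (R n).rank k ≤ b n},
      ENNReal.ofReal
        ((⨅ k' : (R n).S₁ k, ‖((R n).M k - (R n).M k') (R n).fvec‖ ^ 2) /
          (R n).penalty σ (lam n) d k)) atTop (𝓝 0)

end Conditions

/-! Write P = (λ log n − 1) r_k + d √n log n for the selected model k and s² for the variance
estimate. The estimate comes from k itself, so IC(k) = s² P. For k' in `S₁ k`, Pythagoras gives the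
exact ratio 1 + ‖(M_k − M_{k'})Y‖² / (s² P) − λ log n / P. Dropping the square bounds the index
below; any single k' bounds it above. Take k' with small bias, as N3′ allows. It remains that λ log
n / P is small, that s² P is at least a quarter of σ² times the penalty, and that the noise in the
one direction separating k from k' is small against the penalty (`abs_PI_sub_one_le`).

The last two can fail only with small probability for a fixed k, by Chernoff bounds for χ² variables
(`measure_RSS_le`, `measure_le_norm_M_sub_M_sq`). Since k is random, a union bound runs over all
models with rank in [a, b]. One k' is fixed for each k, so only N_j events of each kind are needed,
and N_j ≤ c₀ exp(ρE) because L_j ≥ 1. Condition N1 gives E ≤ (5/16)(n − j), so each bad event has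
probability at most 3 exp(−2ρE), and the total 3c₀ ∑ exp(−ρE) tends to zero by N2′. The same sum
forces E, and hence P, to be large. -/

/-! ### Exponential moments of Gaussian vectors and their projections -/

/-- Exponential moment of a noncentral `χ²` variable with one degree of freedom. -/
lemma integral_exp_neg_mul_add_sq_gaussianReal {s : ℝ} (hs : -1 < 2 * s) (c : ℝ) :
    ∫ x, Real.exp (-s * (x + c) ^ 2) ∂(gaussianReal 0 1) =
      (√(1 + 2 * s))⁻¹ * Real.exp (-s * c ^ 2 / (1 + 2 * s)) := by
  have hq : 0 < 1 + 2 * s := by linarith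
  have hq0 : 1 + 2 * s ≠ 0 := hq.ne'
  set w : NNReal := ⟨(1 + 2 * s)⁻¹, by positivity⟩ with hw
  have hw0 : w ≠ 0 := by
    intro h
    have : ((1 + 2 * s)⁻¹ : ℝ) = 0 := congrArg NNReal.toReal h
    exact (inv_pos.2 hq).ne' this
  rw [integral_gaussianReal_eq_integral_smul one_ne_zero]
  -- Completing the square: the tilted density is a multiple of a normal density of variance 1/(1 +
  -- 2s).
  have key : ∀ x : ℝ, gaussianPDFReal 0 1 x • Real.exp (-s * (x + c) ^ 2) =
      (√(1 + 2 * s))⁻¹ * Real.exp (-s * c ^ 2 / (1 + 2 * s)) *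
        gaussianPDFReal (-2 * s * c / (1 + 2 * s)) w x := by
    intro x
    have hwv : (w : ℝ) = (1 + 2 * s)⁻¹ := rfl
    simp only [gaussianPDFReal, hwv, smul_eq_mul, NNReal.coe_one, mul_one, sub_zero]
    have h1 : √(2 * Real.pi * (1 + 2 * s)⁻¹) = √(2 * Real.pi) * (√(1 + 2 * s))⁻¹ := by
      rw [Real.sqrt_mul (by positivity), Real.sqrt_inv]
    have h2 : √(1 + 2 * s) ≠ 0 := (Real.sqrt_pos.2 hq).ne'
    have h3 : √(2 * Real.pi) ≠ 0 := (Real.sqrt_pos.2 (by positivity)).ne'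
    rw [h1, mul_assoc, ← Real.exp_add]
    have h4 : -s * c ^ 2 / (1 + 2 * s) +
        -(x - -2 * s * c / (1 + 2 * s)) ^ 2 / (2 * (1 + 2 * s)⁻¹) =
        -x ^ 2 / 2 + -s * (x + c) ^ 2 := by
      generalize hqs : 1 + 2 * s = q at hq0
      obtain rfl : s = (q - 1) / 2 := by linarith
      field_simp
      ring
    rw [← h4, Real.exp_add]
    field_simp
  simp_rw [key]
  rw [integral_const_mul, integral_gaussianPDFReal_eq_one _ hw0, mul_one]

section StdGaussian

variable {E : Type*} [NormedAddCommGroup E] [InnerProductSpace ℝ E] [FiniteDimensional ℝ E]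
  [MeasurableSpace E] [BorelSpace E]

/-- Exponential moment of the squared norm of a shifted standard Gaussian vector. -/
lemma integral_exp_neg_mul_norm_add_sq_stdGaussian {s : ℝ} (hs : -1 < 2 * s) (c : E) :
    ∫ x, Real.exp (-s * ‖x + c‖ ^ 2) ∂(stdGaussian E) =
      (√(1 + 2 * s))⁻¹ ^ Module.finrank ℝ E * Real.exp (-s * ‖c‖ ^ 2 / (1 + 2 * s)) := by
  rw [stdGaussian, integral_map (Measurable.aemeasurable (by fun_prop)) (by fun_prop)]
  set b := stdOrthonormalBasis ℝ E
  have h1 : ∀ x : Fin (Module.finrank ℝ E) → ℝ,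
      Real.exp (-s * ‖∑ i, x i • b i + c‖ ^ 2) =
        ∏ i, Real.exp (-s * (x i + inner ℝ (b i) c) ^ 2) := by
    intro x
    rw [← Real.exp_sum, ← Finset.mul_sum, ← b.sum_sq_norm_inner_right]
    congr 2
    refine Finset.sum_congr rfl fun i _ => ?_
    rw [inner_add_right, b.orthonormal.inner_right_fintype, Real.norm_eq_abs, sq_abs]
  simp_rw [h1]
  rw [integral_fintype_prod_eq_prod (f := fun i y => Real.exp (-s * (y + inner ℝ (b i) c) ^ 2))]
  simp_rw [integral_exp_neg_mul_add_sq_gaussianReal hs]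
  rw [Finset.prod_mul_distrib, Finset.prod_const, Finset.card_univ, Fintype.card_fin,
    ← Real.exp_sum, ← Finset.sum_div, ← Finset.mul_sum]
  congr 4
  rw [← b.sum_sq_norm_inner_right]
  exact Finset.sum_congr rfl fun i _ => by rw [Real.norm_eq_abs, sq_abs]

/-- The orthogonal projection of a standard Gaussian vector is a standard Gaussian vector of the
subspace. -/
lemma stdGaussian_map_orthogonalProjectionOnto (W : Submodule ℝ E) :
    (stdGaussian E).map W.orthogonalProjectionOnto = stdGaussian W := by
  have := Measure.isProbabilityMeasure_map (μ := stdGaussian E)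
    W.orthogonalProjectionOnto.continuous.aemeasurable
  apply Measure.ext_of_charFun
  ext t
  -- The adjoint of the projection is the inclusion of W, which preserves the norm, the only thing
  -- the Gaussian characteristic function sees.
  have h : charFun ((stdGaussian E).map W.orthogonalProjectionOnto) t =
      charFun (stdGaussian E) (t : E) := by
    rw [charFun_apply, charFun_apply, integral_map (by fun_prop) (by fun_prop)]
    simp_rw [Submodule.inner_orthogonalProjectionOnto_eq_of_mem_right]
  rw [h, charFun_stdGaussian, charFun_stdGaussian, Submodule.coe_norm]

/-- Exponential moment of the squared norm of the projection of a shifted standard Gaussian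
vector. -/
lemma integral_exp_neg_mul_norm_starProjection_sq_stdGaussian {s : ℝ} (hs : -1 < 2 * s)
    (W : Submodule ℝ E) (c : E) :
    ∫ x, Real.exp (-s * ‖W.starProjection (x + c)‖ ^ 2) ∂(stdGaussian E) =
      (√(1 + 2 * s))⁻¹ ^ Module.finrank ℝ W *
        Real.exp (-s * ‖W.starProjection c‖ ^ 2 / (1 + 2 * s)) := by
  have h := integral_exp_neg_mul_norm_add_sq_stdGaussian hs (W.orthogonalProjectionOnto c)
  rw [← stdGaussian_map_orthogonalProjectionOnto, integral_map (by fun_prop) (by fun_prop)] at h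
  simpa only [Submodule.starProjection_apply, Submodule.coe_norm, map_add,
    Submodule.coe_add] using h

end StdGaussian

/-! ### Chernoff bounds for χ² variables -/

section StdGaussianTails

variable {E : Type*} [NormedAddCommGroup E] [InnerProductSpace ℝ E] [FiniteDimensional ℝ E]
  [MeasurableSpace E] [BorelSpace E]

/-- Chernoff bound for the lower tail of a noncentral `χ²` variable. -/
lemma stdGaussian_norm_starProjection_sq_le (W : Submodule ℝ E) (c : E) :
    stdGaussian E {x | ‖W.starProjection (x + c)‖ ^ 2 ≤
        (Module.finrank ℝ W + ‖W.starProjection c‖ ^ 2) / 4} ≤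
      ENNReal.ofReal (Real.exp (-(Module.finrank ℝ W / 8 : ℝ))) := by
  have hint := integral_exp_neg_mul_norm_starProjection_sq_stdGaussian
    (s := 1 / 2) (by norm_num) W c
  set m := Module.finrank ℝ W
  set δ := ‖W.starProjection c‖ ^ 2 with hδ
  have hδ0 : 0 ≤ δ := by positivity
  have hpos : 0 < (√(1 + 2 * (1 / 2 : ℝ)))⁻¹ ^ m * Real.exp (-(1 / 2) * δ / (1 + 2 * (1 / 2))) := by
    positivity
  have hI : Integrable (fun x => Real.exp (-(1 / 2) * ‖W.starProjection (x + c)‖ ^ 2))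
      (stdGaussian E) := by
    -- A non-integrable function has integral 0 by convention, but the computed value is positive.
    by_contra h
    rw [integral_undef h] at hint
    exact hpos.ne hint
  have hM := mul_meas_ge_le_integral_of_nonneg (Eventually.of_forall fun x => (Real.exp_pos _).le)
    hI (Real.exp (-(m + δ) / 8))
  rw [hint] at hM
  have hset : {x | ‖W.starProjection (x + c)‖ ^ 2 ≤ (m + δ) / 4} =
      {x | Real.exp (-(m + δ) / 8) ≤ Real.exp (-(1 / 2) * ‖W.starProjection (x + c)‖ ^ 2)} := by
    ext x
    simp only [Set.mem_ofPred_eq, Real.exp_le_exp]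
    constructor <;> intro h <;> linarith
  rw [hset, ← ofReal_measureReal]
  refine ENNReal.ofReal_le_ofReal ?_
  have hsq : (√(1 + 2 * (1 / 2 : ℝ)))⁻¹ ^ m ≤ Real.exp (-(m / 4 : ℝ)) := by
    have h1 : (√(1 + 2 * (1 / 2 : ℝ)))⁻¹ ≤ Real.exp (-(1 / 4)) := by
      rw [Real.exp_neg]
      refine inv_anti₀ (Real.exp_pos _) (Real.le_sqrt_of_sq_le ?_)
      rw [← Real.exp_nat_mul]
      have := Real.exp_le_exp.2 (show ((2 : ℕ) : ℝ) * (1 / 4) ≤ Real.log 2 by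
        have := Real.log_two_gt_d9; push_cast; linarith)
      rw [Real.exp_log two_pos] at this
      linarith
    calc _ ≤ Real.exp (-(1 / 4)) ^ m := pow_le_pow_left₀ (by positivity) h1 m
      _ = _ := by rw [← Real.exp_nat_mul]; congr 1; ring
  -- Halving the exponent δ/4 makes δ cancel against the Markov factor exp(−(m + δ)/8), so the bound
  -- does not depend on the mean.
  have h2 : Real.exp (-(1 / 2) * δ / (1 + 2 * (1 / 2))) ≤ Real.exp (-(δ / 8)) :=
    Real.exp_le_exp.2 (by linarith)
  have h3 := hM.trans (mul_le_mul hsq h2 (Real.exp_pos _).le (Real.exp_pos _).le)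
  have h4 : Real.exp (-(m / 4 : ℝ)) * Real.exp (-(δ / 8)) =
      Real.exp (-(m + δ) / 8) * Real.exp (-(m / 8 : ℝ)) := by
    rw [← Real.exp_add, ← Real.exp_add]; congr 1; ring
  rw [h4] at h3
  exact le_of_mul_le_mul_left h3 (Real.exp_pos _)

/-- Chernoff bound for the upper tail of a `χ²` variable with one degree of freedom. -/
lemma stdGaussian_le_norm_starProjection_sq (W : Submodule ℝ E) (hW : Module.finrank ℝ W = 1)
    (τ : ℝ) :
    stdGaussian E {x | τ ≤ ‖W.starProjection x‖ ^ 2} ≤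
      ENNReal.ofReal (2 * Real.exp (-(τ / 4))) := by
  have hint := integral_exp_neg_mul_norm_starProjection_sq_stdGaussian
    (s := -(1 / 4)) (by norm_num) W 0
  simp only [add_zero, map_zero, norm_zero, hW, pow_one, neg_neg] at hint
  have hpos : 0 < (√(1 + 2 * -(1 / 4) : ℝ))⁻¹ *
      Real.exp (1 / 4 * (0 : ℝ) ^ 2 / (1 + 2 * -(1 / 4))) := by
    have : (0 : ℝ) < 1 + 2 * -(1 / 4) := by norm_num
    positivity
  have hI : Integrable (fun x => Real.exp (1 / 4 * ‖W.starProjection x‖ ^ 2))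
      (stdGaussian E) := by
    by_contra h
    rw [integral_undef h] at hint
    exact hpos.ne hint
  have hM := mul_meas_ge_le_integral_of_nonneg (Eventually.of_forall fun x => (Real.exp_pos _).le)
    hI (Real.exp (τ / 4))
  rw [hint] at hM
  have hset : {x | τ ≤ ‖W.starProjection x‖ ^ 2} =
      {x | Real.exp (τ / 4) ≤ Real.exp (1 / 4 * ‖W.starProjection x‖ ^ 2)} := by
    ext x
    simp only [Set.mem_ofPred_eq, Real.exp_le_exp]
    constructor <;> intro h <;> linarith
  rw [hset, ← ofReal_measureReal]
  refine ENNReal.ofReal_le_ofReal ?_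
  have h2 : (√(1 + 2 * -(1 / 4) : ℝ))⁻¹ ≤ 2 := by
    rw [inv_le_comm₀ (by norm_num) two_pos]
    exact Real.le_sqrt_of_sq_le (by norm_num)
  have h3 : Real.exp (1 / 4 * (0 : ℝ) ^ 2 / (1 + 2 * -(1 / 4))) = 1 := by norm_num
  rw [h3, mul_one] at hM
  have h4 := hM.trans h2
  rw [Real.exp_neg, ← div_eq_mul_inv, le_div_iff₀ (Real.exp_pos _), mul_comm]
  exact h4

end StdGaussianTails

/-! ### Nested orthogonal projections -/

section Projections

variable {E : Type*} [NormedAddCommGroup E] [InnerProductSpace ℝ E] [FiniteDimensional ℝ E]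

/-- What remains of y is the residual from V plus the projection on U, both orthogonal to Uᗮ ⊓ V.
For ranks differing by one this space is a line, whence a χ² variable with one degree of freedom. -/
lemma Submodule.starProjection_sub_starProjection_apply {U V : Submodule ℝ E} (h : U ≤ V) (y : E) :
    V.starProjection y - U.starProjection y = (Uᗮ ⊓ V).starProjection y := by
  refine (Submodule.eq_starProjection_of_mem_of_inner_eq_zero
    (Submodule.mem_inf.2 ⟨?_, ?_⟩) fun w hw => ?_).symm
  · rw [Submodule.mem_orthogonal']
    intro u hu
    have h1 := V.starProjection_inner_eq_zero y u (h hu)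
    have h2 := U.starProjection_inner_eq_zero y u hu
    rw [inner_sub_left] at h1 h2 ⊢
    linarith
  · exact V.sub_mem (V.starProjection_apply_mem y) (h (U.starProjection_apply_mem y))
  · have h1 := V.starProjection_inner_eq_zero y w hw.2
    have h2 := (Submodule.mem_orthogonal _ _).1 hw.1 _ (U.starProjection_apply_mem y)
    rw [← sub_add, inner_add_left, h1, h2, add_zero]

lemma Submodule.norm_sub_starProjection_sq_of_le {U V : Submodule ℝ E} (h : U ≤ V) (y : E) :
    ‖y - U.starProjection y‖ ^ 2 =
      ‖y - V.starProjection y‖ ^ 2 + ‖V.starProjection y - U.starProjection y‖ ^ 2 := by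
  have h1 : y - U.starProjection y =
      (y - V.starProjection y) + (V.starProjection y - U.starProjection y) := by abel
  rw [h1, sq, sq, sq]
  refine norm_add_sq_eq_norm_sq_add_norm_sq_real ?_
  exact V.starProjection_inner_eq_zero y _
    (V.sub_mem (V.starProjection_apply_mem y) (h (U.starProjection_apply_mem y)))

end Projections

/-! ### Standardizing the errors -/

section Noise

variable {Ω : Type v} [MeasurableSpace Ω] {μ : Measure Ω} {n : ℕ}

/-- A vector of independent centred normal errors is a multiple of a standard Gaussian vector. -/
lemma hasLaw_stdGaussian_of_iIndepFun [IsProbabilityMeasure μ] {σ : ℝ} (hσ : 0 < σ)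
    {e : Fin n → Ω → ℝ}
    (hlaw : ∀ l, HasLaw (e l) (gaussianReal 0 (σ ^ 2).toNNReal) μ) (hind : iIndepFun e μ) :
    HasLaw (fun ω => WithLp.toLp 2 fun l => σ⁻¹ * e l ω)
      (stdGaussian (EuclideanSpace ℝ (Fin n))) μ := by
  have h1 : ∀ l, HasLaw (fun ω => σ⁻¹ * e l ω) (gaussianReal 0 1) μ := by
    intro l
    convert! gaussianReal_const_mul (hlaw l) σ⁻¹ using 2
    · simp
    · ext
      have : Real.toNNReal (σ ^ 2) = σ ^ 2 := Real.coe_toNNReal _ (by positivity)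
      simp only [NNReal.coe_one, NNReal.coe_mul, this, NNReal.coe_mk]
      field_simp
  have h2 : iIndepFun (fun l ω => σ⁻¹ * e l ω) μ :=
    hind.comp (fun _ x => σ⁻¹ * x) fun _ => by fun_prop
  have hm : ∀ l, AEMeasurable (fun ω => σ⁻¹ * e l ω) μ := fun l => (h1 l).aemeasurable
  have h3 := (iIndepFun_iff_map_fun_eq_pi_map hm).1 h2
  simp_rw [fun l => (h1 l).map_eq] at h3
  refine ⟨(by fun_prop : Measurable (WithLp.toLp 2 : (Fin n → ℝ) → _)).comp_aemeasurable
    (aemeasurable_pi_lambda _ hm), ?_⟩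
  rw [← map_pi_eq_stdGaussian, ← h3, AEMeasurable.map_map_of_aemeasurable (by fun_prop)
    (aemeasurable_pi_lambda _ hm)]
  rfl

end Noise

/-! ### Column spaces and tail bounds for a single model -/

namespace RegressionProblem

variable {n p : ℕ} {Γ : Type u} (R : RegressionProblem n p Γ)

lemma rank_eq (k : Γ) : R.rank k = Module.finrank ℝ ((R.model k).colSpace R.design) := by
  rw [rank, M, Submodule.range_starProjection]

/-- Each basis function is the member of its family with a unit-vector parameter, so it is a
combination of the larger model's basis functions. -/
lemma colSpace_mono {k k' : Γ} (h : (R.model k').family ⊆ (R.model k).family) :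
    (R.model k').colSpace R.design ≤ (R.model k).colSpace R.design := by
  classical
  refine Submodule.span_le.2 ?_
  rintro _ ⟨i, rfl⟩
  obtain ⟨θ, hθ⟩ := h ⟨Pi.single i 1, rfl⟩
  have h1 : (fun l => (R.model k').basis i (R.design l)) =
      fun l => ∑ j, θ j * (R.model k).basis j (R.design l) := by
    funext l
    have := congrFun hθ (R.design l)
    simpa [LinearModel.regFun, Pi.single_apply] using this.symm
  have h2 : (WithLp.toLp 2 fun l => (R.model k').basis i (R.design l)) =
      ∑ j, θ j • (WithLp.toLp 2 fun l => (R.model k).basis j (R.design l) :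
        EuclideanSpace ℝ (Fin n)) := by
    ext l
    simpa using congrFun h1 l
  simp only [SetLike.mem_coe]
  rw [h2]
  exact Submodule.sum_mem _ fun j _ => Submodule.smul_mem _ _ (Submodule.subset_span ⟨j, rfl⟩)

lemma RSS_eq_of_mem_S₁ {k k' : Γ} (h : k' ∈ R.S₁ k) (Y : EuclideanSpace ℝ (Fin n)) :
    R.RSS k' Y = R.RSS k Y + ‖(R.M k - R.M k') Y‖ ^ 2 :=
  Submodule.norm_sub_starProjection_sq_of_le (R.colSpace_mono h.1) Y

section Tails

variable {Ω : Type v} [MeasurableSpace Ω] {μ : Measure Ω} [IsProbabilityMeasure μ]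
  {σ : ℝ} {e : Fin n → Ω → ℝ}

/-- The residual sum of squares of a single model is rarely smaller than a quarter of its mean. -/
lemma measure_RSS_le (hσ : 0 < σ)
    (hlaw : ∀ l, HasLaw (e l) (gaussianReal 0 (σ ^ 2).toNNReal) μ) (hind : iIndepFun e μ) (k : Γ) :
    μ {ω | R.RSS k (R.response fun l => e l ω) ≤
        ((n - R.rank k) * σ ^ 2 + R.approxErr k) / 4} ≤
      ENNReal.ofReal (Real.exp (-(((n : ℝ) - R.rank k) / 8))) := by
  set V := (R.model k).colSpace R.design
  have hrank : (Module.finrank ℝ Vᗮ : ℝ) = n - R.rank k := by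
    have := V.finrank_add_finrank_orthogonal
    rw [finrank_euclideanSpace_fin, ← R.rank_eq k] at this
    have h : ((R.rank k + Module.finrank ℝ Vᗮ : ℕ) : ℝ) = n := congrArg Nat.cast this
    push_cast at h
    linarith
  have hproj : ∀ y, Vᗮ.starProjection y = y - R.M k y := fun y =>
    Submodule.starProjection_orthogonal_val y
  have hT := stdGaussian_norm_starProjection_sq_le Vᗮ (σ⁻¹ • R.fvec)
  have hL := hasLaw_stdGaussian_of_iIndepFun hσ hlaw hind
  rw [← hL.map_eq, Measure.map_apply_of_aemeasurable hL.aemeasurable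
    (measurableSet_le (by fun_prop) (by fun_prop)), hrank] at hT
  refine (measure_mono fun ω hω => ?_).trans hT
  simp only [Set.mem_ofPred_eq, Set.mem_preimage] at hω ⊢
  have hY : R.response (fun l => e l ω) =
      σ • ((WithLp.toLp 2 fun l => σ⁻¹ * e l ω) + σ⁻¹ • R.fvec) := by
    ext l
    simp only [response, fvec, PiLp.smul_apply, PiLp.add_apply, smul_eq_mul]
    field_simp
    ring
  rw [RSS, ← hproj, hY, map_smul, norm_smul, approxErr, mul_pow, Real.norm_eq_abs, sq_abs] at hω
  rw [map_smul, norm_smul, mul_pow, norm_inv, Real.norm_eq_abs, inv_pow, sq_abs, hproj R.fvec]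
  have hσ2 : 0 < σ ^ 2 := by positivity
  refine le_of_mul_le_mul_left (hω.trans (le_of_eq ?_)) hσ2
  field_simp

/-- The error rarely has a large component in the direction separating a model from a sub-model of
rank smaller by one. -/
lemma measure_le_norm_M_sub_M_sq (hσ : 0 < σ)
    (hlaw : ∀ l, HasLaw (e l) (gaussianReal 0 (σ ^ 2).toNNReal) μ) (hind : iIndepFun e μ)
    {k k' : Γ} (h : k' ∈ R.S₁ k) (τ : ℝ) :
    μ {ω | τ * σ ^ 2 ≤ ‖(R.M k - R.M k') (WithLp.toLp 2 fun l => e l ω)‖ ^ 2} ≤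
      ENNReal.ofReal (2 * Real.exp (-(τ / 4))) := by
  set V := (R.model k).colSpace R.design
  set U := (R.model k').colSpace R.design
  have hUV : U ≤ V := R.colSpace_mono h.1
  have hrank : Module.finrank ℝ ↥(Uᗮ ⊓ V) = 1 := by
    have h1 := Submodule.finrank_add_inf_finrank_orthogonal hUV
    have h2 := h.2
    rw [R.rank_eq, R.rank_eq] at h2
    change Module.finrank ℝ U + 1 = Module.finrank ℝ V at h2
    omega
  have hproj : ∀ y, (R.M k - R.M k') y = (Uᗮ ⊓ V).starProjection y := fun y =>
    Submodule.starProjection_sub_starProjection_apply hUV y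
  have hT := stdGaussian_le_norm_starProjection_sq (Uᗮ ⊓ V) hrank τ
  have hL := hasLaw_stdGaussian_of_iIndepFun hσ hlaw hind
  rw [← hL.map_eq, Measure.map_apply_of_aemeasurable hL.aemeasurable
    (measurableSet_le (by fun_prop) (by fun_prop))] at hT
  refine (measure_mono fun ω hω => ?_).trans hT
  simp only [Set.mem_ofPred_eq, Set.mem_preimage] at hω ⊢
  have hY : (WithLp.toLp 2 fun l => e l ω) =
      σ • (WithLp.toLp 2 fun l => σ⁻¹ * e l ω : EuclideanSpace ℝ (Fin n)) := by
    ext l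
    simp only [PiLp.smul_apply, smul_eq_mul]
    field_simp
  rw [hproj, hY, map_smul, norm_smul, mul_pow, Real.norm_eq_abs, sq_abs] at hω
  exact le_of_mul_le_mul_left (by linarith) (by positivity : 0 < σ ^ 2)

end Tails

end RegressionProblem

/-! ### Algebra of the criterion and of the index -/

namespace RegressionProblem

variable {n p : ℕ} {Γ : Type u} (R : RegressionProblem n p Γ) {σ lam d : ℝ}

lemma response_eq (e : Fin n → ℝ) : R.response e = R.fvec + WithLp.toLp 2 e := rfl

/-- The criterion at the model from which the variance is estimated. -/
lemma IC_varEst_self {k : Γ} (hk : R.rank k < n) (Y : EuclideanSpace ℝ (Fin n)) :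
    R.IC lam d k (R.varEst k Y) Y = R.varEst k Y *
      ((lam * Real.log n - 1) * R.rank k + d * √(n : ℝ) * Real.log n) := by
  have h : (0 : ℝ) < n - R.rank k := sub_pos.2 (by exact_mod_cast hk)
  have h1 : R.RSS k Y = R.varEst k Y * (n - R.rank k) := by
    rw [varEst, div_mul_cancel₀ _ h.ne']
  rw [IC, h1]
  ring

/-- The criterion at a sub-model of rank smaller by one. -/
lemma IC_eq_of_mem_S₁ {k k' : Γ} (h : k' ∈ R.S₁ k) (s2 : ℝ) (Y : EuclideanSpace ℝ (Fin n)) :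
    R.IC lam d k' s2 Y =
      R.IC lam d k s2 Y + ‖(R.M k - R.M k') Y‖ ^ 2 - lam * Real.log n * s2 := by
  have hr : (R.rank k : ℝ) = R.rank k' + 1 := by rw [← h.2]; push_cast; ring
  rw [IC, IC, R.RSS_eq_of_mem_S₁ h, hr]
  ring

/-- The parametricness index is close to one when the residual sum of squares is not too small and
a single sub-model differs little from the selected model. -/
lemma abs_PI_sub_one_le (hσ : 0 < σ) {k : Γ} (hk1 : 1 < R.rank k) (hkn : R.rank k < n)
    (hlam : 0 ≤ lam * Real.log n)
    (hP : 0 < (lam * Real.log n - 1) * R.rank k + d * √(n : ℝ) * Real.log n)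
    {e : Fin n → ℝ}
    (hRSS : ((n - R.rank k) * σ ^ 2 + R.approxErr k) / 4 < R.RSS k (R.response e))
    {k' : Γ} (hk' : k' ∈ R.S₁ k) {δ η : ℝ}
    (hf : ‖(R.M k - R.M k') R.fvec‖ ^ 2 ≤ δ * R.penalty σ lam d k)
    (he : ‖(R.M k - R.M k') (WithLp.toLp 2 e)‖ ^ 2 ≤ η * R.penalty σ lam d k * σ ^ 2) :
    |R.PI lam d k (R.response e) - 1| ≤ 8 * δ / σ ^ 2 + 8 * η + lam * Real.log n /
      ((lam * Real.log n - 1) * R.rank k + d * √(n : ℝ) * Real.log n) := by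
  set Y := R.response e with hY
  set P := (lam * Real.log n - 1) * R.rank k + d * √(n : ℝ) * Real.log n with hPdef
  set s2 := R.varEst k Y with hs2
  have hm : (0 : ℝ) < n - R.rank k := sub_pos.2 (by exact_mod_cast hkn)
  have hσ2 : 0 < σ ^ 2 := by positivity
  have hA : 0 ≤ R.approxErr k := by unfold approxErr; positivity
  have hs2pos : 0 < s2 := div_pos (lt_of_le_of_lt (by positivity) hRSS) hm
  -- The left side is P times the mean of the variance estimate, which `hRSS` bounds by four times
  -- its value.
  have hpen : R.penalty σ lam d k * σ ^ 2 ≤ 4 * (s2 * P) := by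
    have h1 : R.penalty σ lam d k * σ ^ 2 =
        P * (((n - R.rank k) * σ ^ 2 + R.approxErr k) / (n - R.rank k)) := by
      rw [penalty, ← hPdef]
      field_simp
    have h2 : ((n - R.rank k) * σ ^ 2 + R.approxErr k) / (n - R.rank k) ≤ 4 * s2 := by
      rw [hs2, varEst, ← mul_div_assoc]
      gcongr
      linarith
    rw [h1]
    nlinarith [mul_le_mul_of_nonneg_left h2 hP.le]
  have hpen0 : 0 ≤ R.penalty σ lam d k := by
    rw [penalty, ← hPdef]
    positivity
  have hD : 0 < s2 * P := mul_pos hs2pos hP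
  have hratio : ∀ i : R.S₁ k, R.IC lam d i s2 Y / R.IC lam d k s2 Y =
      1 + ‖(R.M k - R.M i) Y‖ ^ 2 / (s2 * P) - lam * Real.log n / P := by
    intro i
    rw [R.IC_eq_of_mem_S₁ i.2, hs2, R.IC_varEst_self hkn, ← hs2, ← hPdef]
    field_simp
  have hne : Nonempty (R.S₁ k) := ⟨⟨k', hk'⟩⟩
  -- Also the boundedness below that a real infimum needs in `hle`.
  have hlow : ∀ i : R.S₁ k, 1 - lam * Real.log n / P ≤
      R.IC lam d i s2 Y / R.IC lam d k s2 Y := by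
    intro i
    rw [hratio]
    have : 0 ≤ ‖(R.M k - R.M i) Y‖ ^ 2 / (s2 * P) := by positivity
    linarith
  have hPI : R.PI lam d k Y = ⨅ i : R.S₁ k, R.IC lam d i s2 Y / R.IC lam d k s2 Y := by
    rw [PI, if_pos hk1]
  have hge : 1 - lam * Real.log n / P ≤ R.PI lam d k Y := by
    rw [hPI]
    exact le_ciInf hlow
  have hle : R.PI lam d k Y ≤
      1 + ‖(R.M k - R.M k') Y‖ ^ 2 / (s2 * P) - lam * Real.log n / P := by
    rw [hPI, ← hratio ⟨k', hk'⟩]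
    exact ciInf_le ⟨_, Set.forall_mem_range.2 hlow⟩ _
  -- The 8 is 2 from ‖u + v‖² ≤ 2‖u‖² + 2‖v‖² times 4 from `hpen`.
  have hdiff : ‖(R.M k - R.M k') Y‖ ^ 2 / (s2 * P) ≤ 8 * δ / σ ^ 2 + 8 * η := by
    have h1 : ‖(R.M k - R.M k') Y‖ ^ 2 ≤ 2 * ‖(R.M k - R.M k') R.fvec‖ ^ 2 +
        2 * ‖(R.M k - R.M k') (WithLp.toLp 2 e)‖ ^ 2 := by
      rw [hY, response_eq, map_add]
      have h2 := norm_add_le ((R.M k - R.M k') R.fvec) ((R.M k - R.M k') (WithLp.toLp 2 e))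
      nlinarith [sq_nonneg (‖(R.M k - R.M k') R.fvec‖ - ‖(R.M k - R.M k') (WithLp.toLp 2 e)‖),
        norm_nonneg ((R.M k - R.M k') R.fvec + (R.M k - R.M k') (WithLp.toLp 2 e))]
    have h2 : ‖(R.M k - R.M k') Y‖ ^ 2 ≤
        (2 * (δ / σ ^ 2) + 2 * η) * (R.penalty σ lam d k * σ ^ 2) := by
      refine h1.trans ((add_le_add (mul_le_mul_of_nonneg_left hf two_pos.le)
        (mul_le_mul_of_nonneg_left he two_pos.le)).trans (le_of_eq ?_))
      field_simp
    rw [div_le_iff₀ hD]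
    rcases (mul_nonneg hpen0 hσ2.le).eq_or_lt with h0 | h0
    · have hR : 0 < 4 * (s2 * P) := by positivity
      have : R.penalty σ lam d k = 0 := by
        rcases mul_eq_zero.1 h0.symm with h | h
        · exact h
        · exact absurd h hσ2.ne'
      have h3 : 0 < R.penalty σ lam d k := by
        rw [penalty, ← hPdef]
        positivity
      exact absurd this h3.ne'
    -- No sign is assumed for δ and η; `h2` bounds a square, which forces this one.
    · have hnn : 0 ≤ 2 * (δ / σ ^ 2) + 2 * η := by
        by_contra hneg
        have := mul_neg_of_neg_of_pos (not_le.1 hneg) h0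
        linarith [sq_nonneg ‖(R.M k - R.M k') Y‖]
      refine h2.trans ((mul_le_mul_of_nonneg_left hpen hnn).trans (le_of_eq ?_))
      ring
  have hl0 : 0 ≤ lam * Real.log n / P := by positivity
  have hd0 : 0 ≤ ‖(R.M k - R.M k') Y‖ ^ 2 / (s2 * P) := by positivity
  rw [abs_le]
  constructor <;> linarith

/-! ### Bounds on E and on the number of models -/

section Ranks

lemma penalty_nonneg (hlam : 1 ≤ lam * Real.log n) (hd : 0 ≤ d) {k : Γ} (hk : R.rank k < n) :
    0 ≤ R.penalty σ lam d k := by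
  have hm : (0 : ℝ) < n - R.rank k := sub_pos.2 (by exact_mod_cast hk)
  have hA : 0 ≤ R.approxErr k := by unfold approxErr; positivity
  have h1 : 0 ≤ lam * Real.log n - 1 := by linarith
  have h2 : 0 ≤ Real.log n := Real.log_natCast_nonneg n
  unfold penalty
  positivity

lemma E_le_penalty (hlam : 1 ≤ lam * Real.log n) (hd : 0 ≤ d) {k : Γ} (hk : R.rank k < n) :
    R.E σ lam d (R.rank k) ≤ R.penalty σ lam d k := by
  refine ciInf_le (f := fun i : {i // R.rank i = R.rank k} => R.penalty σ lam d i)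
    ⟨0, Set.forall_mem_range.2 fun i => ?_⟩ ⟨k, rfl⟩
  exact R.penalty_nonneg hlam hd (i.2.trans_lt hk)

/-- Bounds on `E_{j,n}` when `B_{j,n} / (n - j)` is small. -/
lemma E_le_of_B_le (hσ : 0 < σ) (hlam : 1 ≤ lam * Real.log n) (hd : 0 ≤ d) {j : ℕ} (hj : j < n)
    (hfin : {k | R.rank k = j}.Finite) (hne : ∃ k, R.rank k = j)
    (hB : R.B σ lam d j / (n - j) ≤ 1 / 4) :
    R.E σ lam d j ≤ 5 / 4 * ((lam * Real.log n - 1) * j + d * √(n : ℝ) * Real.log n) ∧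
      R.E σ lam d j ≤ 5 / 16 * (n - j) := by
  have hm : (0 : ℝ) < n - j := sub_pos.2 (by exact_mod_cast hj)
  have : Finite {k // R.rank k = j} := hfin
  have : Nonempty {k // R.rank k = j} := hne.elim fun k hk => ⟨⟨k, hk⟩⟩
  -- At a minimizer of B, the penalty bracket and the scaled squared bias are each at most (n −
  -- j)/4, so the bias factor in the penalty is at most 5/4.
  obtain ⟨⟨k, rfl⟩, hk⟩ := exists_eq_ciInf_of_finite (f := fun k : {k // R.rank k = j} =>
    ((lam * Real.log n - 1) * j + R.approxErr k / σ ^ 2 + d * √(n : ℝ) * Real.log n))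
  have hBk : R.B σ lam d (R.rank k) = (lam * Real.log n - 1) * R.rank k +
      R.approxErr k / σ ^ 2 + d * √(n : ℝ) * Real.log n := hk.symm
  have hE := R.E_le_penalty (σ := σ) hlam hd hj
  have hA : 0 ≤ R.approxErr k := by unfold approxErr; positivity
  have h1 : 0 ≤ lam * Real.log n - 1 := by linarith
  have h2 : 0 ≤ Real.log n := Real.log_natCast_nonneg n
  rw [penalty] at hE
  set P := (lam * Real.log n - 1) * R.rank k + d * √(n : ℝ) * Real.log n with hP
  have hP0 : 0 ≤ P := by positivity
  have hA' : 0 ≤ R.approxErr k / σ ^ 2 := by positivity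
  rw [div_le_iff₀ hm, hBk] at hB
  have h3 : R.approxErr k / ((n - R.rank k) * σ ^ 2) ≤ 1 / 4 := by
    rw [mul_comm, ← div_div, div_le_iff₀ hm]
    linarith
  have h4 : P * (1 + R.approxErr k / ((n - R.rank k) * σ ^ 2)) ≤ P * (5 / 4) :=
    mul_le_mul_of_nonneg_left (by linarith) hP0
  constructor <;> linarith

/-- A bound on `N_j L_j` bounds the number of models of rank `j`. -/
lemma finite_and_ncard_le (hS : ∀ k, 1 < R.rank k → (R.S₁ k).Nonempty) {j : ℕ} (hj : 1 < j)
    (hne : ∃ k, R.rank k = j) {C : ℝ} (hC : 0 ≤ C)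
    (h : ((R.N j * R.L j : ℕ∞) : ℝ≥0∞) ≤ ENNReal.ofReal C) :
    {k | R.rank k = j}.Finite ∧ ({k | R.rank k = j}.ncard : ℝ) ≤ C := by
  obtain ⟨k, hk⟩ := hne
  have hL : 1 ≤ R.L j := by
    refine le_iSup₂_of_le k hk ?_
    exact Set.one_le_encard_iff_nonempty.2 (hS k (hk ▸ hj))
  have h1 : ((R.N j : ℕ∞) : ℝ≥0∞) ≤ ENNReal.ofReal C :=
    (ENat.toENNReal_le.2 (le_mul_of_one_le_right' hL)).trans h
  have hfin : {k | R.rank k = j}.Finite := by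
    rw [← Set.encard_ne_top_iff]
    intro htop
    rw [N, htop] at h1
    simp at h1
  refine ⟨hfin, ?_⟩
  rw [N, ← hfin.cast_ncard_eq] at h1
  rw [ENat.toENNReal_coe, ← ENNReal.ofReal_natCast] at h1
  exact (ENNReal.ofReal_le_ofReal_iff hC).1 h1

end Ranks

end RegressionProblem

/-! ### Union bound over the candidate models -/

lemma MeasureTheory.measure_biUnion_le_ncard_mul {Ω : Type*} [MeasurableSpace Ω] {μ : Measure Ω}
    {ι : Type*} {s : Set ι} (hs : s.Finite) (A : ι → Set Ω) {x : ℝ}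
    (h : ∀ i ∈ s, μ (A i) ≤ ENNReal.ofReal x) :
    μ (⋃ i ∈ s, A i) ≤ ENNReal.ofReal (s.ncard * x) := by
  have h1 : (⋃ i ∈ s, A i) = ⋃ i ∈ hs.toFinset, A i := by simp
  rw [h1]
  refine (measure_biUnion_finset_le _ _).trans ((Finset.sum_le_card_nsmul _ _ _ fun i hi =>
    h i (hs.mem_toFinset.1 hi)).trans ?_)
  rw [← Set.ncard_eq_toFinset_card s hs, nsmul_eq_mul, ENNReal.ofReal_mul (by positivity),
    ENNReal.ofReal_natCast]

namespace RegressionProblem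

variable {n p : ℕ} {Γ : Type u} (R : RegressionProblem n p Γ) {σ lam d : ℝ}
  {Ω : Type v} [MeasurableSpace Ω] {μ : Measure Ω} [IsProbabilityMeasure μ]

lemma mem_ranks {a b j : ℕ} : j ∈ R.ranks a b ↔ (a ≤ j ∧ j ≤ b) ∧ ∃ k, R.rank k = j := by
  simp [ranks]

/-- Finite-sample bound for the probability that the parametricness index is far from one. -/
lemma measure_le_abs_PI_sub_one (hσ : 0 < σ) {e : Fin n → Ω → ℝ}
    (hlaw : ∀ l, HasLaw (e l) (gaussianReal 0 (σ ^ 2).toNNReal) μ) (hind : iIndepFun e μ)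
    (hS : ∀ k, 1 < R.rank k → (R.S₁ k).Nonempty)
    (hlam : 1 ≤ lam * Real.log n) (hd : 0 ≤ d)
    {khat : Ω → Γ} (hkhat : ∀ k, MeasurableSet {ω | khat ω = k})
    {a b : ℕ} {t ρ c₀ : ℝ} (ht : 0 < t) (ha : 1 < a) (hat : 8 / t ≤ a) (hb : b < n)
    (hρ0 : 0 < ρ) (hρt : ρ ≤ t / 256) (hρ : ρ ≤ 1 / 8) (hc₀ : 0 < c₀)
    (hB : ∀ j ∈ R.ranks a b, R.B σ lam d j / (n - j) ≤ 1 / 4)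
    (hNL : ∀ j ∈ R.ranks a b, ((R.N j * R.L j : ℕ∞) : ℝ≥0∞) ≤
      ENNReal.ofReal (c₀ * Real.exp (ρ * R.E σ lam d j)))
    (hE : ∀ j ∈ R.ranks a b, 10 / t ≤ R.E σ lam d j)
    (hf : ∀ k, a ≤ R.rank k → R.rank k ≤ b →
      (⨅ k' : R.S₁ k, ‖(R.M k - R.M k') R.fvec‖ ^ 2) / R.penalty σ lam d k < t * σ ^ 2 / 32) :
    μ {ω | t ≤ |R.PI lam d (khat ω) (R.response fun l => e l ω) - 1|} ≤
      (1 - μ {ω | a ≤ R.rank (khat ω) ∧ R.rank (khat ω) ≤ b}) +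
        ENNReal.ofReal (3 * c₀ * ∑ j ∈ R.ranks a b, Real.exp (-(ρ * R.E σ lam d j))) := by
  have hcard : ∀ j ∈ R.ranks a b, {k | R.rank k = j}.Finite ∧
      ({k | R.rank k = j}.ncard : ℝ) ≤ c₀ * Real.exp (ρ * R.E σ lam d j) := fun j hj => by
    have hj' := R.mem_ranks.1 hj
    exact R.finite_and_ncard_le hS (ha.trans_le hj'.1.1) hj'.2 (by positivity) (hNL j hj)
  have hbound : ∀ j ∈ R.ranks a b,
      R.E σ lam d j ≤ 5 / 4 * ((lam * Real.log n - 1) * j + d * √(n : ℝ) * Real.log n) ∧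
        R.E σ lam d j ≤ 5 / 16 * (n - j) := fun j hj => by
    have hj' := R.mem_ranks.1 hj
    exact R.E_le_of_B_le hσ hlam hd (hj'.1.2.trans_lt hb) (hcard j hj).1 hj'.2 (hB j hj)
  have hmem : ∀ k, a ≤ R.rank k → R.rank k ≤ b → R.rank k ∈ R.ranks a b := fun k h1 h2 =>
    R.mem_ranks.2 ⟨⟨h1, h2⟩, k, rfl⟩
  have hpen : ∀ k, a ≤ R.rank k → R.rank k ≤ b → R.E σ lam d (R.rank k) ≤ R.penalty σ lam d k ∧
      0 < R.penalty σ lam d k := fun k h1 h2 => by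
    have h3 := R.E_le_penalty (σ := σ) hlam hd (h2.trans_lt hb)
    exact ⟨h3, (by positivity : 0 < 10 / t).trans_le ((hE _ (hmem k h1 h2)).trans h3)⟩
  have hsub : ∀ k, a ≤ R.rank k ∧ R.rank k ≤ b → ∃ k' ∈ R.S₁ k,
      ‖(R.M k - R.M k') R.fvec‖ ^ 2 ≤ t * σ ^ 2 / 32 * R.penalty σ lam d k := fun k hk => by
    have h1 := hf k hk.1 hk.2
    rw [div_lt_iff₀ (hpen k hk.1 hk.2).2] at h1
    have : Nonempty (R.S₁ k) := (hS k (ha.trans_le hk.1)).to_subtype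
    obtain ⟨⟨k', hk'⟩, h2⟩ := exists_lt_of_ciInf_lt h1
    exact ⟨k', hk', h2.le⟩
  choose! sub hsub_mem hsub_le using hsub
  set bad : Γ → Set Ω := fun k =>
    {ω | R.RSS k (R.response fun l => e l ω) ≤
        ((n - R.rank k) * σ ^ 2 + R.approxErr k) / 4} ∪
      {ω | t / 32 * R.penalty σ lam d k * σ ^ 2 ≤
        ‖(R.M k - R.M (sub k)) (WithLp.toLp 2 fun l => e l ω)‖ ^ 2} with hbad
  have hbad_le : ∀ j ∈ R.ranks a b, ∀ k ∈ {k | R.rank k = j},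
      μ (bad k) ≤ ENNReal.ofReal (3 * Real.exp (-(2 * ρ * R.E σ lam d j))) := by
    rintro j hj k rfl
    have hj' := (R.mem_ranks.1 hj).1
    have hE0 : 0 < R.E σ lam d (R.rank k) := (by positivity : 0 < 10 / t).trans_le (hE _ hj)
    have h1 := R.measure_RSS_le hσ hlaw hind k
    have h2 := R.measure_le_norm_M_sub_M_sq hσ hlaw hind (hsub_mem k hj')
      (t / 32 * R.penalty σ lam d k)
    -- 2ρE ≤ E/4 ≤ 5(n − r)/64 ≤ (n − r)/8.
    have h3 : Real.exp (-((n - R.rank k) / 8 : ℝ)) ≤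
        Real.exp (-(2 * ρ * R.E σ lam d (R.rank k))) := by
      refine Real.exp_le_exp.2 (neg_le_neg ?_)
      have := (hbound _ hj).2
      have h4 := mul_le_mul_of_nonneg_right hρ hE0.le
      linarith
    -- The exponent is t/128 times the penalty, hence the requirement ρ ≤ t/256.
    have h4 : 2 * Real.exp (-(t / 32 * R.penalty σ lam d k / 4)) ≤
        2 * Real.exp (-(2 * ρ * R.E σ lam d (R.rank k))) := by
      refine mul_le_mul_of_nonneg_left (Real.exp_le_exp.2 (neg_le_neg ?_)) two_pos.le
      have h5 := mul_le_mul hρt (hpen k hj'.1 hj'.2).1 hE0.le (by positivity)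
      linarith
    refine (measure_union_le _ _).trans ((add_le_add (h1.trans (ENNReal.ofReal_le_ofReal h3))
      (h2.trans (ENNReal.ofReal_le_ofReal h4))).trans ?_)
    rw [← ENNReal.ofReal_add (by positivity) (by positivity)]
    exact ENNReal.ofReal_le_ofReal (by linarith)
  have hunion : μ (⋃ j ∈ R.ranks a b, ⋃ k ∈ {k | R.rank k = j}, bad k) ≤
      ENNReal.ofReal (3 * c₀ * ∑ j ∈ R.ranks a b, Real.exp (-(ρ * R.E σ lam d j))) := by
    refine (measure_biUnion_finset_le _ _).trans ((Finset.sum_le_sum fun j hj =>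
      measure_biUnion_le_ncard_mul (hcard j hj).1 bad (hbad_le j hj)).trans ?_)
    rw [← ENNReal.ofReal_sum_of_nonneg fun j _ => by positivity]
    refine ENNReal.ofReal_le_ofReal ?_
    rw [Finset.mul_sum]
    refine Finset.sum_le_sum fun j hj => ?_
    refine (mul_le_mul_of_nonneg_right (hcard j hj).2 (by positivity)).trans (le_of_eq ?_)
    have : Real.exp (-(ρ * R.E σ lam d j)) =
        Real.exp (ρ * R.E σ lam d j) * Real.exp (-(2 * ρ * R.E σ lam d j)) := by
      rw [← Real.exp_add]; congr 1; ring
    rw [this]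
    ring
  -- Only the fibres of `khat` are known to be measurable; finitely many of them make up this event.
  have hmeas : MeasurableSet {ω | a ≤ R.rank (khat ω) ∧ R.rank (khat ω) ≤ b} := by
    have hfin : {k | a ≤ R.rank k ∧ R.rank k ≤ b}.Finite :=
      ((R.ranks a b).finite_toSet.biUnion fun j hj => (hcard j hj).1).subset fun k hk =>
        Set.mem_biUnion (hmem k hk.1 hk.2) rfl
    convert! hfin.measurableSet_biUnion fun k _ => hkhat k
    ext ω
    simp
  rw [← prob_compl_eq_one_sub hmeas]
  refine (measure_mono fun ω hω => ?_).trans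
    ((measure_union_le _ _).trans (add_le_add le_rfl hunion))
  by_contra hnot
  rw [Set.mem_union, not_or, Set.notMem_compl_iff] at hnot
  obtain ⟨hrange, hgood⟩ := hnot
  simp only [Set.mem_ofPred_eq] at hrange hω
  set k := khat ω
  have hk := hmem k hrange.1 hrange.2
  have hgood' : ω ∉ bad k := fun h => hgood (Set.mem_biUnion hk (Set.mem_biUnion rfl h))
  simp only [hbad, Set.mem_union, Set.mem_ofPred_eq, not_or, not_le] at hgood'
  have hP := (hE _ hk).trans (hbound _ hk).1
  set P := (lam * Real.log n - 1) * R.rank k + d * √(n : ℝ) * Real.log n with hPdef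
  have hP8 : 8 / t ≤ P := by
    have : 10 / t = 5 / 4 * (8 / t) := by ring
    linarith
  have hPpos : 0 < P := (by positivity : 0 < 8 / t).trans_le hP8
  have hmain := R.abs_PI_sub_one_le hσ (ha.trans_le hrange.1) (hrange.2.trans_lt hb)
    (zero_le_one.trans hlam) hPpos hgood'.1 (hsub_mem k hrange) (hsub_le k hrange) hgood'.2.le
  rw [← hPdef] at hmain
  -- If λ log n ≤ 2, the size of P suffices; otherwise λ log n − 1 ≥ λ log n / 2 and the rank is at
  -- least 8/t.
  have hratio : lam * Real.log n / P ≤ t / 4 := by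
    rw [div_le_iff₀ hPpos]
    have h1 : 0 ≤ d * √(n : ℝ) * Real.log n := by
      have := Real.log_natCast_nonneg n
      positivity
    rcases le_total (lam * Real.log n) 2 with h2 | h2
    · have : t / 4 * (8 / t) = 2 := by field_simp; norm_num
      have := mul_le_mul_of_nonneg_left hP8 (by positivity : 0 ≤ t / 4)
      linarith
    · have h3 : (8 / t : ℝ) ≤ R.rank k := hat.trans (by exact_mod_cast hrange.1)
      have h4 : lam * Real.log n / 2 * (8 / t) ≤ P := by
        have h5 : lam * Real.log n / 2 * (8 / t) ≤ (lam * Real.log n - 1) * R.rank k :=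
          mul_le_mul (by linarith) h3 (by positivity) (by linarith)
        linarith
      have h5 := mul_le_mul_of_nonneg_left h4 (by positivity : 0 ≤ t / 4)
      have h6 : t / 4 * (lam * Real.log n / 2 * (8 / t)) = lam * Real.log n := by
        field_simp
        ring
      linarith
  -- Bias, noise and `hratio` contribute t/4 each, in total less than t.
  have h7 : 8 * (t * σ ^ 2 / 32) / σ ^ 2 = t / 4 := by field_simp; norm_num
  rw [h7] at hmain
  linarith

end RegressionProblem

/-! ### Passage to the limit -/

theorem theorem3 {Ω : Type v} [MeasurableSpace Ω] (μ : Measure Ω) [IsProbabilityMeasure μ]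
    (p : ℕ → ℕ) (Γ : ℕ → Type u)
    -- design, true regression function and list of models at each sample size
    (R : ∀ n, RegressionProblem n (p n) (Γ n))
    -- independent normal errors with variance `σ²`
    (σ : ℝ) (hσ : 0 < σ)
    (ε : ∀ n, Fin n → Ω → ℝ)
    (hε_law : ∀ n l, HasLaw (ε n l) (gaussianReal 0 (σ ^ 2).toNNReal) μ)
    (hε_indep : ∀ n, iIndepFun (ε n) μ)
    -- every model of rank larger than one has a sub-model of rank smaller by one
    (hS : ∀ n k, 1 < (R n).rank k → ((R n).S₁ k).Nonempty)
    -- the constants of the criterion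
    (lam : ℕ → ℝ) (hlam : ∀ n : ℕ, 2 ≤ n → (Real.log n)⁻¹ ≤ lam n)
    (d : ℝ) (hd : 0 ≤ d)
    -- the selected model
    (khat : ∀ n, Ω → Γ n) (hkhat : ∀ n k, MeasurableSet {ω | khat n ω = k})
    -- nonparametric scenario: no model in the list is true
    (hnonpar : ∀ n k, (R n).f ∉ ((R n).model k).family)
    (a b : ℕ → ℕ)
    (hab : ∀ᶠ n in atTop, 1 ≤ a n ∧ a n < b n ∧ b n < n)
    (ha : Tendsto a atTop atTop)
    (hN1 : CondN1 μ R σ lam d khat a b)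
    (hN2 : CondN2' R σ lam d a b)
    (hN3 : CondN3' R σ lam d a b) :
    TendstoInMeasure μ
      (fun n ω => (R n).PI (lam n) d (khat n ω) ((R n).response fun l => ε n l ω))
      atTop (fun _ => 1) := by
  obtain ⟨hrange, hB⟩ := hN1
  obtain ⟨ρ, c₀, hρ0, hρ, hc₀, hNL, hsum⟩ := hN2
  rw [tendstoInMeasure_iff_dist]
  intro t ht
  have hlim : Tendsto (fun n =>
      (1 - μ {ω | a n ≤ (R n).rank (khat n ω) ∧ (R n).rank (khat n ω) ≤ b n}) +
        ENNReal.ofReal (3 * c₀ *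
          ∑ j ∈ (R n).ranks (a n) (b n), Real.exp (-(ρ n * (R n).E σ (lam n) d j))))
      atTop (𝓝 0) := by
    have h1 := ENNReal.Tendsto.sub (tendsto_const_nhds (x := (1 : ℝ≥0∞)) (f := atTop)) hrange
      (Or.inl ENNReal.one_ne_top)
    have h2 := ENNReal.tendsto_ofReal (hsum.const_mul (3 * c₀))
    simpa using h1.add h2
  refine tendsto_of_tendsto_of_tendsto_of_le_of_le' tendsto_const_nhds hlim
    (Eventually.of_forall fun _ => zero_le) ?_
  have eB := hB.eventually_lt_const (ENNReal.ofReal_pos.2 (by norm_num : (0 : ℝ) < 1 / 4))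
  have ef := hN3.eventually_lt_const (ENNReal.ofReal_pos.2 (by positivity : 0 < t * σ ^ 2 / 32))
  have eE := hsum.eventually_lt_const (Real.exp_pos (-(10 / t)))
  have eρ1 := hρ.eventually_lt_const (by positivity : 0 < t / 256)
  have eρ2 := hρ.eventually_lt_const (by norm_num : (0 : ℝ) < 1 / 8)
  have ea := (tendsto_natCast_atTop_atTop (R := ℝ)).comp ha |>.eventually_ge_atTop (8 / t)
  filter_upwards [hab, ha.eventually_gt_atTop 1, ea, eB, ef, eE, eρ1, eρ2, hNL,
    eventually_ge_atTop 2] with n hn hna hat hBn hfn hEn hρ1 hρ2 hNLn hn2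
  have hlog : 0 < Real.log n := Real.log_pos (by exact_mod_cast hn2)
  have hl : 1 ≤ lam n * Real.log n := (inv_le_iff_one_le_mul₀ hlog).1 (hlam n hn2)
  simp_rw [Real.dist_eq]
  refine (R n).measure_le_abs_PI_sub_one hσ (hε_law n) (hε_indep n) (hS n) hl hd (hkhat n) ht hna
    hat hn.2.2 (hρ0 n) hρ1.le hρ2.le hc₀ (fun j hj => ?_) (fun j hj => ?_) (fun j hj => ?_)
    (fun k hk1 hk2 => ?_)
  · exact ((ENNReal.ofReal_lt_ofReal_iff (by norm_num)).1
      ((le_iSup₂_of_le j hj le_rfl).trans_lt hBn)).le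
  · exact hNLn j hj (hna.trans_le ((R n).mem_ranks.1 hj).1.1)
  -- One term of the sum is below exp(−10/t), so ρE > 10/t; as ρ < 1, also E > 10/t.
  · have h1 := (Finset.single_le_sum (f := fun j => Real.exp (-(ρ n * (R n).E σ (lam n) d j)))
      (fun j _ => (Real.exp_pos _).le) hj).trans_lt hEn
    have h2 : 10 / t < ρ n * (R n).E σ (lam n) d j := by
      have := Real.exp_lt_exp.1 h1
      linarith
    have h3 : 0 < 10 / t := by positivity
    have h4 : 0 < (R n).E σ (lam n) d j := by
      by_contra h
      have := mul_nonpos_of_nonneg_of_nonpos (hρ0 n).le (not_lt.1 h)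
      linarith
    nlinarith
  · exact (ENNReal.ofReal_lt_ofReal_iff (by positivity)).1
      ((le_iSup₂_of_le (f := fun k (_ : k ∈ {k | a n ≤ (R n).rank k ∧ (R n).rank k ≤ b n}) =>
        ENNReal.ofReal
          ((⨅ k' : (R n).S₁ k, ‖((R n).M k - (R n).M k') (R n).fvec‖ ^ 2) /
            (R n).penalty σ (lam n) d k)) k ⟨hk1, hk2⟩ le_rfl).trans_lt hfn)
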